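/- Write $\mathbb T=\mathbb R/2\pi\mathbb Z$. Let $(w,z,k,a)$ be a solution of class $C^2$ on $\mathbb T\times[-\varepsilon,T)$ (one-sided in $t$ at $t=-\varepsilon$) of the azimuthal Euler system $$\partial_t w+\lambda_3\partial_\theta w=-\tfrac83 aw+\tfrac1{24}(w-z)^2\partial_\theta k,\qquad \partial_t z+\lambda_1\partial_\theta z=-\tfrac83 az+\tfrac1{24}(w-z)^2\partial_\theta k,$$ $$\partial_t k+\lambda_2\partial_\theta k=0,\qquad \partial_t a+\lambda_2\partial_\theta a=-\tfrac43a^2+\tfrac13(w+z)^2-\tfrac16(w-z)^2,$$ where $\lambda_1=\tfrac13w+z$, $\lambda_2=\tfrac23w+\tfrac23z$, $\lambda_3=w+\tfrac13z$, and put $c=\tfrac12(w-z)$. **Lemma.** For every $M\ge 1$ there is a constant $C>0$, depending only on $M$, with the following property. Let $\beta_1>-1$, $\gamma_1>0$, $0<\varepsilon\le1$ and $-\varepsilon\le T\le\varepsilon$, let $(w,z,k,a)$ be a solution as above whose initial slope satisfies $|\partial_\theta w(\theta,-\varepsilon)|\le\frac1\varepsilon$ for all $\theta$, and suppose that on $\mathbb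 T\times[-\varepsilon,T)$ $$\tfrac1M\le w\le M,\quad \tfrac1M\le c\le M,\quad |k|,|a|\le M,\quad |\partial_\theta z|\le M\varepsilon^{\beta_1},\quad |\partial_\theta k|\le M\varepsilon^{\gamma_1},\quad |\partial_\theta a|\le M.$$ Let $\varphi>0$ and let $\Psi$ be the flow of the speed $\lambda=(1-\varphi)w+(\tfrac13+\varphi)z$, that is, $\Psi(x,-\varepsilon)=x$ and $\partial_t\Psi(x,t)=\lambda(\Psi(x,t),t)$ for $t\in[-\varepsilon,T)$. Then for all $x$ and all $t\in[-\varepsilon,T]$ the function $\tau\mapsto|\partial_\theta w(\Psi(x,\tau),\tau)|$ is integrable on $[-\varepsilon,t]$ and $$\int_{-\varepsilon}^t|\partial_\theta w(\Psi(x,\tau),\tau)|\,d\tau\;\le\; C\,\max\Big(1,\frac1\varphi\Big)\,\frac{\varepsilon+t}{\varepsilon}.$$ In particular, for $0<\varphi\le1$, which includes the first and second wave speeds $\lambda_1$ ($\varphi=\tfrac23$), $\lambda_2$ ($\varphi=\tfrac13$) and every speed between $\lambda_1$ and $\lambda_3$, the bound is $\frac C\varphi\,\frac{\varepsilon+t}\varepsilon$,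 with $C$ uniform in $\varphi$, $x$, $t$ and $\varepsilon$. -/

import Mathlib

/-!
Functions on the circle of length `2 * π` are represented by `2 * π`-periodic functions of a
real variable `θ`.  A space-time function is `f : ℝ → ℝ → ℝ`, with `f θ t` its value at the angle
`θ` and the time `t`.
-/

namespace AzimuthalEuler

/-- The time interval `[-ε, T)`. -/
def timeInterval (ε T : ℝ) : Set ℝ := Set.Ico (-ε) T

/-- The partial derivative of `f` in `θ`. -/
noncomputable def dTheta (f : ℝ → ℝ → ℝ) (θ t : ℝ) : ℝ := deriv (fun x => f x t) θ

/-- The partial derivative of `f` in `t` on `[-ε, T)`, which is one-sided at `t = -ε`. -/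
noncomputable def dTime (ε T : ℝ) (f : ℝ → ℝ → ℝ) (θ t : ℝ) : ℝ :=
  derivWithin (fun s => f θ s) (timeInterval ε T) t

/-- The sound speed `c = (w - z) / 2`. -/
noncomputable def soundSpeed (w z : ℝ → ℝ → ℝ) (θ t : ℝ) : ℝ := (w θ t - z θ t) / 2

/-- The first wave speed `w / 3 + z`. -/
noncomputable def lam1 (w z : ℝ → ℝ → ℝ) (θ t : ℝ) : ℝ := 1 / 3 * w θ t + z θ t

/-- The second wave speed `2 w / 3 + 2 z / 3`. -/
noncomputable def lam2 (w z : ℝ → ℝ → ℝ) (θ t : ℝ) : ℝ := 2 / 3 * w θ t + 2 / 3 * z θ t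

/-- The third wave speed `w + z / 3`. -/
noncomputable def lam3 (w z : ℝ → ℝ → ℝ) (θ t : ℝ) : ℝ := w θ t + 1 / 3 * z θ t

/-- The speed `(1 - φ) w + (1 / 3 + φ) z`; it is the third, second and first wave speed for
`φ = 0`, `φ = 1 / 3` and `φ = 2 / 3`. -/
noncomputable def speed (φ : ℝ) (w z : ℝ → ℝ → ℝ) (θ t : ℝ) : ℝ :=
  (1 - φ) * w θ t + (1 / 3 + φ) * z θ t

/-- `f` is `2 * π`-periodic in `θ` and of class `C²` on `𝕋 × [-ε, T)`, up to the initial time. -/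
structure IsRegular (ε T : ℝ) (f : ℝ → ℝ → ℝ) : Prop where
  periodic : ∀ t ∈ timeInterval ε T, Function.Periodic (fun θ => f θ t) (2 * Real.pi)
  contDiffOn : ContDiffOn ℝ 2 (Function.uncurry f) (Set.univ ×ˢ timeInterval ε T)

/-- `(w, z, k, a)` is a classical solution on `𝕋 × [-ε, T)` of the 2d Euler equations in azimuthal
symmetry with adiabatic exponent `2`, written in the Riemann variables `w`, `z`, the entropy `k`
and the (rescaled) radial velocity `a`. -/
structure IsSolution (ε T : ℝ) (w z k a : ℝ → ℝ → ℝ) : Prop where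
  regular_w : IsRegular ε T w
  regular_z : IsRegular ε T z
  regular_k : IsRegular ε T k
  regular_a : IsRegular ε T a
  eq_w : ∀ θ, ∀ t ∈ timeInterval ε T,
    dTime ε T w θ t + lam3 w z θ t * dTheta w θ t =
      -(8 / 3) * a θ t * w θ t + 1 / 24 * (w θ t - z θ t) ^ 2 * dTheta k θ t
  eq_z : ∀ θ, ∀ t ∈ timeInterval ε T,
    dTime ε T z θ t + lam1 w z θ t * dTheta z θ t =
      -(8 / 3) * a θ t * z θ t + 1 / 24 * (w θ t - z θ t) ^ 2 * dTheta k θ t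
  eq_k : ∀ θ, ∀ t ∈ timeInterval ε T,
    dTime ε T k θ t + lam2 w z θ t * dTheta k θ t = 0
  eq_a : ∀ θ, ∀ t ∈ timeInterval ε T,
    dTime ε T a θ t + lam2 w z θ t * dTheta a θ t =
      -(4 / 3) * a θ t ^ 2 + 1 / 3 * (w θ t + z θ t) ^ 2 - 1 / 6 * (w θ t - z θ t) ^ 2

/-- `Ψ x t` is the flow of the speed `v`, started from the identity at time `-ε`.  (It takes values
in `ℝ`: it is the lift of the flow on the circle.) -/
structure IsFlow (ε T : ℝ) (v Ψ : ℝ → ℝ → ℝ) : Prop where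
  initial : ∀ x, Ψ x (-ε) = x
  hasDeriv : ∀ x, ∀ t ∈ timeInterval ε T,
    HasDerivWithinAt (fun s => Ψ x s) (v (Ψ x t) t) (timeInterval ε T) t

/-- The pointwise bounds on `𝕋 × [-ε, T)`, with implicit constant `M`: `w ∼ 1`, `c ∼ 1`,
`|k|, |a| ≲ 1`, `|∂_θ z| ≲ ε ^ β₁`, `|∂_θ k| ≲ ε ^ γ₁`, `|∂_θ a| ≲ 1`. -/
structure HasBounds (M β₁ γ₁ ε T : ℝ) (w z k a : ℝ → ℝ → ℝ) : Prop where
  w_sim : ∀ θ, ∀ t ∈ timeInterval ε T, 1 / M ≤ w θ t ∧ w θ t ≤ M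
  c_sim : ∀ θ, ∀ t ∈ timeInterval ε T, 1 / M ≤ soundSpeed w z θ t ∧ soundSpeed w z θ t ≤ M
  k_le : ∀ θ, ∀ t ∈ timeInterval ε T, |k θ t| ≤ M
  a_le : ∀ θ, ∀ t ∈ timeInterval ε T, |a θ t| ≤ M
  dz_le : ∀ θ, ∀ t ∈ timeInterval ε T, |dTheta z θ t| ≤ M * ε ^ β₁
  dk_le : ∀ θ, ∀ t ∈ timeInterval ε T, |dTheta k θ t| ≤ M * ε ^ γ₁
  da_le : ∀ θ, ∀ t ∈ timeInterval ε T, |dTheta a θ t| ≤ M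

end AzimuthalEuler

/-! Along `λ₃`, the slope `W = ∂_θ w` obeys a Riccati equation with leading term `-W²`, once the
correction `q = W - (w - z)/8 · ∂_θ k` has removed the second derivative of the entropy. The
quadratic term pushes `q` down. A maximum principle therefore gives `W ≤ 9M²/ε` for all times
(`dTheta_le`), while steepening towards `-∞` remains possible. For a time of order `ε/M⁴` the slope
cannot move far, and `|W| ≤ 9M²/ε` (`abs_dTheta_le`).

The negative part is controlled by transversality: the speed `λ` equals `λ₃ - 2φc`, so along `Ψ` the
derivative of `w` is a bounded source minus `2φcW`. Since `|W| = 2W⁺ - W`, the upper bound on `W`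
and the total change of the bounded function `w` control `∫|W|` (`abs_dTheta_le_deriv_flow`). The
change of `w` costs a constant multiple of `1/φ`, which is dominated by `(ε + t)/ε` only after a
time of order `ε`; before that, the two-sided bound on `W` is integrated instead. -/

namespace AzimuthalEuler

open Set Filter Topology MeasureTheory

/-! ### Maximum principle on the circle -/

/-- A function that is periodic in space, negative at the initial time, and strictly decreasing in
time at every spatial maximum where it vanishes, stays negative. -/
theorem neg_of_periodic_of_deriv_neg {v : ℝ → ℝ → ℝ} {t₀ t₁ P : ℝ} (hP : 0 < P)
    (hcont : ContinuousOn (Function.uncurry v) (univ ×ˢ Icc t₀ t₁))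
    (hper : ∀ t ∈ Icc t₀ t₁, Function.Periodic (fun θ => v θ t) P)
    (hinit : ∀ θ, v θ t₀ < 0)
    (htouch : ∀ θ, ∀ t ∈ Ioc t₀ t₁, v θ t = 0 → IsLocalMax (fun x => v x t) θ →
      ∃ m < 0, HasDerivAt (fun s => v θ s) m t) :
    ∀ θ, ∀ t ∈ Icc t₀ t₁, v θ t < 0 := by
  by_contra! hcon
  obtain ⟨θ₁, s₁, hs₁, hv₁⟩ := hcon
  set K : Set (ℝ × ℝ) := (Icc 0 P ×ˢ Icc t₀ t₁) ∩ {p | 0 ≤ Function.uncurry v p} with hK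
  have hcont' : ContinuousOn (Function.uncurry v) (Icc 0 P ×ˢ Icc t₀ t₁) :=
    hcont.mono (prod_mono (subset_univ _) subset_rfl)
  have hKc : IsCompact K := by
    have h1 : IsClosed K :=
      hcont'.preimage_isClosed_of_isClosed (isClosed_Icc.prod isClosed_Icc) isClosed_Ici
    exact (isCompact_Icc.prod isCompact_Icc).of_isClosed_subset h1 inter_subset_left
  have hmem : ∀ θ, ∀ t ∈ Icc t₀ t₁, 0 ≤ v θ t → ∃ y, (y, t) ∈ K := by
    intro θ t ht h
    obtain ⟨y, hy, hy'⟩ := (hper t ht).exists_mem_Ico₀ hP θ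
    refine ⟨y, ⟨⟨⟨hy.1, hy.2.le⟩, ht⟩, ?_⟩⟩
    exact h.trans_eq hy'
  obtain ⟨y₁, hy₁⟩ := hmem θ₁ s₁ hs₁ hv₁
  -- Periodicity reduces space to a compact interval, so there is a first time at which `v` is
  -- nonnegative somewhere.
  obtain ⟨⟨θ, t⟩, hpK, hmin⟩ := hKc.exists_isMinOn ⟨_, hy₁⟩ continuous_snd.continuousOn
  have ht : t ∈ Icc t₀ t₁ := hpK.1.2
  have hvt : 0 ≤ v θ t := hpK.2
  have hbefore : ∀ x, ∀ s ∈ Ico t₀ t, v x s < 0 := by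
    intro x s hs
    by_contra! h
    obtain ⟨y, hy⟩ := hmem x s ⟨hs.1, hs.2.le.trans ht.2⟩ h
    have := hmin hy
    simp only [mem_ofPred_eq] at this
    linarith [hs.2]
  have ht₀ : t₀ < t := by
    rcases ht.1.lt_or_eq with h | h
    · exact h
    · subst h
      linarith [hinit θ]
  have hle : ∀ x, v x t ≤ 0 := by
    intro x
    have hc : ContinuousWithinAt (fun s => v x s) (Ico t₀ t) t := by
      have h1 : ContinuousOn (fun s => v x s) (Icc t₀ t₁) := by
        have := hcont.comp (f := fun s : ℝ => (x, s)) (s := Icc t₀ t₁) (by fun_prop)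
          (fun s hs => ⟨mem_univ _, hs⟩)
        exact this
      exact (h1 t ht).mono (fun s hs => ⟨hs.1, hs.2.le.trans ht.2⟩)
    have := right_nhdsWithin_Ico_neBot ht₀
    refine le_of_tendsto hc ?_
    filter_upwards [self_mem_nhdsWithin] with s hs using (hbefore x s hs).le
  have h0 : v θ t = 0 := le_antisymm (hle θ) hvt
  obtain ⟨m, hm, hd⟩ := htouch θ t ⟨ht₀, ht.2⟩ h0
    (Eventually.of_forall fun x => by simpa [h0] using hle x)
  have h1 := (hasDerivWithinAt_iff_tendsto_slope' (s := Ico t₀ t) (by simp)).1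
    (hd.hasDerivWithinAt (s := Ico t₀ t))
  have := right_nhdsWithin_Ico_neBot ht₀
  -- Before the first contact `v` is negative, so the backward difference quotients at the contact
  -- point are nonnegative.
  have h2 : 0 ≤ m := by
    refine ge_of_tendsto h1 ?_
    filter_upwards [self_mem_nhdsWithin] with s hs
    rw [slope_def_field, h0]
    exact div_nonneg_of_nonpos (by linarith [hbefore θ s hs]) (by linarith [hs.2])
  linarith

/-! ### Partial derivatives on the slab -/

variable {ε T : ℝ}

theorem uniqueDiffOn_slab (ε T : ℝ) :
    UniqueDiffOn ℝ ((univ : Set ℝ) ×ˢ timeInterval ε T) :=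
  uniqueDiffOn_univ.prod (uniqueDiffOn_Ico _ _)

theorem hasDerivAt_theta {f : ℝ → ℝ → ℝ} {f' : ℝ × ℝ →L[ℝ] ℝ} {θ t : ℝ}
    (ht : t ∈ timeInterval ε T)
    (hf : HasFDerivWithinAt (Function.uncurry f) f' (univ ×ˢ timeInterval ε T) (θ, t)) :
    HasDerivAt (fun x => f x t) (f' (1, 0)) θ := by
  have h1 : HasDerivWithinAt (fun x : ℝ => (x, t)) ((1, 0) : ℝ × ℝ) univ θ :=
    (hasDerivWithinAt_id θ univ).prodMk (hasDerivWithinAt_const θ univ t)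
  have hmaps : MapsTo (fun x : ℝ => (x, t)) univ (univ ×ˢ timeInterval ε T) :=
    fun x _ => ⟨mem_univ _, ht⟩
  have h2 : HasDerivWithinAt (fun x => f x t) (f' (1, 0)) univ θ :=
    HasFDerivWithinAt.comp_hasDerivWithinAt (f := fun x : ℝ => (x, t)) θ hf h1 hmaps
  exact hasDerivWithinAt_univ.1 h2

theorem hasDerivWithinAt_time {f : ℝ → ℝ → ℝ} {f' : ℝ × ℝ →L[ℝ] ℝ} {θ t : ℝ}
    (hf : HasFDerivWithinAt (Function.uncurry f) f' (univ ×ˢ timeInterval ε T) (θ, t)) :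
    HasDerivWithinAt (fun s => f θ s) (f' (0, 1)) (timeInterval ε T) t := by
  have h1 : HasDerivWithinAt (fun s : ℝ => (θ, s)) ((0, 1) : ℝ × ℝ) (timeInterval ε T) t :=
    (hasDerivWithinAt_const t _ θ).prodMk (hasDerivWithinAt_id t _)
  have hmaps : MapsTo (fun s : ℝ => (θ, s)) (timeInterval ε T) (univ ×ˢ timeInterval ε T) :=
    fun s hs => ⟨mem_univ _, hs⟩
  exact HasFDerivWithinAt.comp_hasDerivWithinAt (f := fun s : ℝ => (θ, s)) t hf h1 hmaps

namespace IsRegular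

variable {f : ℝ → ℝ → ℝ}

theorem hasFDerivWithinAt (hf : IsRegular ε T f) (θ : ℝ) {t : ℝ} (ht : t ∈ timeInterval ε T) :
    HasFDerivWithinAt (Function.uncurry f)
      (fderivWithin ℝ (Function.uncurry f) (univ ×ˢ timeInterval ε T) (θ, t))
      (univ ×ˢ timeInterval ε T) (θ, t) :=
  ((hf.contDiffOn.differentiableOn (by norm_num)) (θ, t) ⟨mem_univ _, ht⟩).hasFDerivWithinAt

theorem dTheta_eq (hf : IsRegular ε T f) (θ : ℝ) {t : ℝ} (ht : t ∈ timeInterval ε T) :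
    dTheta f θ t =
      fderivWithin ℝ (Function.uncurry f) (univ ×ˢ timeInterval ε T) (θ, t) (1, 0) :=
  (hasDerivAt_theta ht (hf.hasFDerivWithinAt θ ht)).deriv

theorem dTime_eq (hf : IsRegular ε T f) (θ : ℝ) {t : ℝ} (ht : t ∈ timeInterval ε T) :
    dTime ε T f θ t =
      fderivWithin ℝ (Function.uncurry f) (univ ×ˢ timeInterval ε T) (θ, t) (0, 1) :=
  (hasDerivWithinAt_time (hf.hasFDerivWithinAt θ ht)).derivWithin (uniqueDiffOn_Ico _ _ t ht)

theorem hasDerivAt_dTheta (hf : IsRegular ε T f) (θ : ℝ) {t : ℝ} (ht : t ∈ timeInterval ε T) :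
    HasDerivAt (fun x => f x t) (dTheta f θ t) θ := by
  rw [hf.dTheta_eq θ ht]
  exact hasDerivAt_theta ht (hf.hasFDerivWithinAt θ ht)

theorem hasDerivWithinAt_dTime (hf : IsRegular ε T f) (θ : ℝ) {t : ℝ} (ht : t ∈ timeInterval ε T) :
    HasDerivWithinAt (fun s => f θ s) (dTime ε T f θ t) (timeInterval ε T) t := by
  rw [hf.dTime_eq θ ht]
  exact hasDerivWithinAt_time (hf.hasFDerivWithinAt θ ht)

theorem hasDerivAt_dTime (hf : IsRegular ε T f) (θ : ℝ) {t : ℝ} (ht : t ∈ Ioo (-ε) T) :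
    HasDerivAt (fun s => f θ s) (dTime ε T f θ t) t :=
  (hf.hasDerivWithinAt_dTime θ (Ioo_subset_Ico_self ht)).hasDerivAt (Ico_mem_nhds ht.1 ht.2)

theorem continuousOn (hf : IsRegular ε T f) :
    ContinuousOn (Function.uncurry f) (univ ×ˢ timeInterval ε T) :=
  hf.contDiffOn.continuousOn

theorem continuousOn_dTheta (hf : IsRegular ε T f) :
    ContinuousOn (Function.uncurry (dTheta f)) (univ ×ˢ timeInterval ε T) := by
  have h : ContinuousOn (fun p : ℝ × ℝ =>
      fderivWithin ℝ (Function.uncurry f) (univ ×ˢ timeInterval ε T) p (1, 0))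
      (univ ×ˢ timeInterval ε T) :=
    (hf.contDiffOn.continuousOn_fderivWithin (uniqueDiffOn_slab ε T) (by norm_num)).clm_apply
      continuousOn_const
  exact h.congr fun p hp => hf.dTheta_eq p.1 hp.2

theorem periodic_dTheta (hf : IsRegular ε T f) {t : ℝ} (ht : t ∈ timeInterval ε T) :
    Function.Periodic (fun θ => dTheta f θ t) (2 * Real.pi) := by
  intro θ
  have h := hf.periodic t ht
  have h2 : (fun x => f (x + 2 * Real.pi) t) = fun x => f x t := funext h
  simp only [dTheta]
  rw [← deriv_comp_add_const (fun x => f x t), h2]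

/-- Interior mixed second derivatives of a regular function agree. -/
theorem exists_hasDerivAt_mixed (hf : IsRegular ε T f) (θ : ℝ) {t : ℝ} (ht : t ∈ Ioo (-ε) T) :
    ∃ m n, HasDerivAt (fun x => dTime ε T f x t) m θ ∧ HasDerivAt (fun s => dTheta f θ s) m t ∧
      HasDerivAt (fun x => dTheta f x t) n θ := by
  have hintg : ∀ p ∈ (univ : Set ℝ) ×ˢ Ioo (-ε) T, (univ : Set ℝ) ×ˢ timeInterval ε T ∈ 𝓝 p :=
    fun p hp => prod_mem_nhds univ_mem (Ico_mem_nhds hp.2.1 hp.2.2)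
  have hat : ContDiffAt ℝ 2 (Function.uncurry f) (θ, t) :=
    hf.contDiffOn.contDiffAt (hintg _ ⟨mem_univ _, ht⟩)
  have hsym : IsSymmSndFDerivAt ℝ (Function.uncurry f) (θ, t) :=
    hat.isSymmSndFDerivAt (by simp)
  have hdd : HasFDerivAt (fderiv ℝ (Function.uncurry f))
      (fderiv ℝ (fderiv ℝ (Function.uncurry f)) (θ, t)) (θ, t) :=
    ((hat.fderiv_right (m := 1) (by norm_num)).differentiableAt (by norm_num)).hasFDerivAt
  set D := fderiv ℝ (fderiv ℝ (Function.uncurry f)) (θ, t)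
  have hx : HasDerivAt (fun x : ℝ => (x, t)) ((1, 0) : ℝ × ℝ) θ :=
    (hasDerivAt_id θ).prodMk (hasDerivAt_const θ t)
  have hs : HasDerivAt (fun s : ℝ => (θ, s)) ((0, 1) : ℝ × ℝ) t :=
    (hasDerivAt_const t θ).prodMk (hasDerivAt_id t)
  have hdx : HasDerivAt (fun x => fderiv ℝ (Function.uncurry f) (x, t)) (D (1, 0)) θ :=
    hdd.comp_hasDerivAt θ hx
  have hds : HasDerivAt (fun s => fderiv ℝ (Function.uncurry f) (θ, s)) (D (0, 1)) t :=
    hdd.comp_hasDerivAt t hs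
  have hT : ∀ x, ∀ s ∈ Ioo (-ε) T,
      dTime ε T f x s = fderiv ℝ (Function.uncurry f) (x, s) (0, 1) := fun x s hs => by
    rw [hf.dTime_eq x (Ioo_subset_Ico_self hs), fderivWithin_of_mem_nhds (hintg _ ⟨mem_univ _, hs⟩)]
  have hΘ : ∀ x, ∀ s ∈ Ioo (-ε) T,
      dTheta f x s = fderiv ℝ (Function.uncurry f) (x, s) (1, 0) := fun x s hs => by
    rw [hf.dTheta_eq x (Ioo_subset_Ico_self hs),
      fderivWithin_of_mem_nhds (hintg _ ⟨mem_univ _, hs⟩)]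
  refine ⟨D (1, 0) (0, 1), D (1, 0) (1, 0), ?_, ?_, ?_⟩
  · have := hdx.clm_apply (hasDerivAt_const θ ((0, 1) : ℝ × ℝ))
    simp only [map_zero, add_zero] at this
    exact this.congr_of_eventuallyEq (Eventually.of_forall fun x => hT x t ht)
  · have := hds.clm_apply (hasDerivAt_const t ((1, 0) : ℝ × ℝ))
    simp only [map_zero, add_zero] at this
    rw [hsym.eq (1, 0) (0, 1)]
    refine this.congr_of_eventuallyEq ?_
    filter_upwards [Ioo_mem_nhds ht.1 ht.2] with s hs using hΘ θ s hs
  · have := hdx.clm_apply (hasDerivAt_const θ ((1, 0) : ℝ × ℝ))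
    simp only [map_zero, add_zero] at this
    exact this.congr_of_eventuallyEq (Eventually.of_forall fun x => hΘ x t ht)

end IsRegular

/-! ### Riccati equation for the corrected slope -/

/-- The slope of `w` corrected by the entropy gradient. Its transport equation along the third
wave speed contains no second derivative of the entropy. -/
noncomputable def goodSlope (w z k : ℝ → ℝ → ℝ) (θ t : ℝ) : ℝ :=
  dTheta w θ t - (w θ t - z θ t) / 8 * dTheta k θ t

/-- The right-hand side of the Riccati equation of `goodSlope`, in terms of the values of
`∂_θ w`, `∂_θ z`, `∂_θ k`, `∂_θ a`, `w - z`, `w` and `a`. -/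
noncomputable def riccati (W Z K A d w a : ℝ) : ℝ :=
  -W ^ 2 - W * (Z / 3 + 8 / 3 * a - d * K / 6) + (-(8 / 3) * A * w + d * K * (a / 3 + Z / 12))

/-- Since `λ₃ - λ₂ = (w - z)/3`, transporting `∂_θ k` along `λ₃` instead of `λ₂` leaves `(w - z)/3 ·
∂_θ² k`. The factor `(w - z)/8` turns this into the term `(w - z)²/24 · ∂_θ² k` of the
differentiated `w`-equation, and the two cancel. -/
theorem IsSolution.goodSlope_transport {w z k a : ℝ → ℝ → ℝ} (h : IsSolution ε T w z k a)
    (θ : ℝ) {t : ℝ} (ht : t ∈ Ioo (-ε) T) :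
    ∃ qθ qt, HasDerivAt (fun x => goodSlope w z k x t) qθ θ ∧
      HasDerivAt (fun s => goodSlope w z k θ s) qt t ∧
      qt + lam3 w z θ t * qθ = riccati (dTheta w θ t) (dTheta z θ t) (dTheta k θ t) (dTheta a θ t)
        (w θ t - z θ t) (w θ t) (a θ t) := by
  have ht' : t ∈ timeInterval ε T := Ioo_subset_Ico_self ht
  obtain ⟨wm, wn, hwT, hwm, hwn⟩ := h.regular_w.exists_hasDerivAt_mixed θ ht
  obtain ⟨km, kn, hkT, hkm, hkn⟩ := h.regular_k.exists_hasDerivAt_mixed θ ht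
  have hw := h.regular_w.hasDerivAt_dTheta θ ht'
  have hz := h.regular_z.hasDerivAt_dTheta θ ht'
  have ha := h.regular_a.hasDerivAt_dTheta θ ht'
  have hwt := h.regular_w.hasDerivAt_dTime θ ht
  have hzt := h.regular_z.hasDerivAt_dTime θ ht
  have e1 := (hwT.add ((hw.add (hz.const_mul (1 / 3))).mul hwn)).unique
    ((((ha.const_mul (-(8 / 3))).mul hw).add
      ((((hw.sub hz).pow 2).const_mul (1 / 24)).mul hkn)).congr_of_eventuallyEq
      (Eventually.of_forall fun x => h.eq_w x t ht'))
  have e2 := (hkT.add (((hw.const_mul (2 / 3)).add (hz.const_mul (2 / 3))).mul hkn)).unique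
    ((hasDerivAt_const θ (0 : ℝ)).congr_of_eventuallyEq
      (Eventually.of_forall fun x => h.eq_k x t ht'))
  have e3 := h.eq_w θ t ht'
  have e4 := h.eq_z θ t ht'
  refine ⟨_, _, hwn.sub (((hw.sub hz).div_const 8).mul hkn),
    hwm.sub (((hwt.sub hzt).div_const 8).mul hkm), ?_⟩
  simp only [lam1, lam3, riccati, Pi.add_apply, Pi.sub_apply, Pi.pow_apply] at *
  push_cast at e1
  -- `e1` and `e2` are the `θ`-derivatives of the equations for `w` and `k`; `e3 - e4` accounts for
  -- the derivative falling on the factor `w - z`.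
  linear_combination e1 - (w θ t - z θ t) / 8 * e2 - dTheta k θ t / 8 * (e3 - e4)

theorem continuousOn_goodSlope {w z k : ℝ → ℝ → ℝ} (hw : IsRegular ε T w) (hz : IsRegular ε T z)
    (hk : IsRegular ε T k) :
    ContinuousOn (Function.uncurry (goodSlope w z k)) (univ ×ˢ timeInterval ε T) :=
  hw.continuousOn_dTheta.sub
    (((hw.continuousOn.sub hz.continuousOn).div_const 8).mul hk.continuousOn_dTheta)

theorem periodic_goodSlope {w z k : ℝ → ℝ → ℝ} (hw : IsRegular ε T w) (hz : IsRegular ε T z)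
    (hk : IsRegular ε T k) {t : ℝ} (ht : t ∈ timeInterval ε T) :
    Function.Periodic (fun θ => goodSlope w z k θ t) (2 * Real.pi) := by
  intro θ
  have h1 := hw.periodic t ht θ
  have h2 := hz.periodic t ht θ
  have h3 := hw.periodic_dTheta ht θ
  have h4 := hk.periodic_dTheta ht θ
  simp only at h1 h2 h3 h4
  simp only [goodSlope, h1, h2, h3, h4]

/-! ### Size of the Riccati right-hand side -/

section RiccatiBounds

variable {M E W Z K A d w a : ℝ}

theorem abs_riccati_linear_le (hM : 1 ≤ M) (hE : 1 ≤ E) (hZ : |Z| ≤ M * E) (hK : |K| ≤ M)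
    (ha : |a| ≤ M) (hd : |d| ≤ 2 * M) : |Z / 3 + 8 / 3 * a - d * K / 6| ≤ 4 * M ^ 2 * E := by
  have h1 : |d * K| ≤ 2 * M * M := by
    rw [abs_mul]; exact mul_le_mul hd hK (abs_nonneg _) (by linarith)
  have h2 : M ≤ M ^ 2 := by nlinarith
  have h3 : M ^ 2 ≤ M ^ 2 * E := le_mul_of_one_le_right (by positivity) hE
  have h4 : M * E ≤ M ^ 2 * E := mul_le_mul_of_nonneg_right h2 (by linarith)
  rw [abs_le] at *
  constructor <;> nlinarith

theorem abs_riccati_source_le (hM : 1 ≤ M) (hE : 1 ≤ E) (hZ : |Z| ≤ M * E) (hK : |K| ≤ M)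
    (hA : |A| ≤ M) (ha : |a| ≤ M) (hd : |d| ≤ 2 * M) (hw : |w| ≤ M) :
    |-(8 / 3) * A * w + d * K * (a / 3 + Z / 12)| ≤ 4 * M ^ 4 * E ^ 2 := by
  have hM0 : 0 ≤ M := by linarith
  have h1 : |d * K| ≤ 2 * M ^ 2 := by
    rw [abs_mul]
    calc |d| * |K| ≤ 2 * M * M := mul_le_mul hd hK (abs_nonneg _) (by linarith)
      _ = 2 * M ^ 2 := by ring
  have h2 : |A * w| ≤ M ^ 2 := by
    rw [abs_mul, sq]; exact mul_le_mul hA hw (abs_nonneg _) hM0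
  have h5 : M ≤ M * E := le_mul_of_one_le_right hM0 hE
  have h3 : |a / 3 + Z / 12| ≤ 5 / 12 * (M * E) := by
    rw [abs_le] at *
    constructor <;> linarith
  have h4 : |d * K * (a / 3 + Z / 12)| ≤ 2 * M ^ 2 * (5 / 12 * (M * E)) := by
    rw [abs_mul]; exact mul_le_mul h1 h3 (abs_nonneg _) (by positivity)
  have hEE : E ≤ E ^ 2 := by nlinarith
  have hMM : M ^ 3 ≤ M ^ 4 := pow_le_pow_right₀ hM (by norm_num)
  have hMM' : M ^ 2 ≤ M ^ 4 := pow_le_pow_right₀ hM (by norm_num)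
  have h6 : M ^ 3 * E ≤ M ^ 4 * E ^ 2 := mul_le_mul hMM hEE (by linarith) (by positivity)
  have h7 : M ^ 2 ≤ M ^ 4 * E ^ 2 :=
    hMM'.trans (le_mul_of_one_le_right (by positivity) (by nlinarith))
  have h8 := abs_add_le (-(8 / 3) * A * w) (d * K * (a / 3 + Z / 12))
  have h9 : |-(8 / 3) * A * w| = 8 / 3 * |A * w| := by
    rw [mul_assoc, abs_mul]; norm_num
  nlinarith

/-- With `P = M²E`, the linear coefficient is at most `4P` and the source at most `4P²`, whereas
`W(W - 4P) ≥ 21P²`. -/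
theorem riccati_neg (hM : 1 ≤ M) (hE : 1 ≤ E) (hZ : |Z| ≤ M * E) (hK : |K| ≤ M)
    (hA : |A| ≤ M) (ha : |a| ≤ M) (hd : |d| ≤ 2 * M) (hw : |w| ≤ M) (hW : 7 * M ^ 2 * E ≤ W) :
    riccati W Z K A d w a < 0 := by
  have h1 := (abs_le.1 (abs_riccati_linear_le hM hE hZ hK ha hd)).1
  have h2 := (abs_le.1 (abs_riccati_source_le hM hE hZ hK hA ha hd hw)).2
  have hP : 0 < M ^ 2 * E := by positivity
  have h3 : W * -(Z / 3 + 8 / 3 * a - d * K / 6) ≤ W * (4 * M ^ 2 * E) :=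
    mul_le_mul_of_nonneg_left (by linarith) (by linarith)
  have h4 : 7 * M ^ 2 * E * (3 * (M ^ 2 * E)) ≤ W * (W - 4 * M ^ 2 * E) :=
    mul_le_mul hW (by linarith) (by positivity) (by linarith)
  have h5 : 0 < M ^ 4 * E ^ 2 := by positivity
  unfold riccati
  nlinarith

/-- With `P = M²E`, the quadratic, linear and source terms contribute at most `16P² + 16P² + 4P²`.
-/
theorem neg_riccati_lt (hM : 1 ≤ M) (hE : 1 ≤ E) (hZ : |Z| ≤ M * E) (hK : |K| ≤ M)
    (hA : |A| ≤ M) (ha : |a| ≤ M) (hd : |d| ≤ 2 * M) (hw : |w| ≤ M) (hW : |W| ≤ 4 * M ^ 2 * E) :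
    -riccati W Z K A d w a < 40 * M ^ 4 * E ^ 2 := by
  have h1 := abs_riccati_linear_le hM hE hZ hK ha hd
  have h2 := (abs_le.1 (abs_riccati_source_le hM hE hZ hK hA ha hd hw)).1
  have h3 : |W * (Z / 3 + 8 / 3 * a - d * K / 6)| ≤ 4 * M ^ 2 * E * (4 * M ^ 2 * E) := by
    rw [abs_mul]; exact mul_le_mul hW h1 (abs_nonneg _) (by positivity)
  have h3' := (abs_le.1 h3).2
  have h4 : W ^ 2 ≤ (4 * M ^ 2 * E) ^ 2 := sq_le_sq' (abs_le.1 hW).1 (abs_le.1 hW).2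
  have h5 : 0 < M ^ 4 * E ^ 2 := by positivity
  unfold riccati
  nlinarith

end RiccatiBounds

/-! ### Bounds on the slope of `w` -/

/-- The bounds on the coefficients in the Riccati equation, in terms of `M` and `1 / ε` only. -/
structure CoeffBounds (M ε T : ℝ) (w z k a : ℝ → ℝ → ℝ) : Prop where
  dz_le : ∀ θ, ∀ t ∈ timeInterval ε T, |dTheta z θ t| ≤ M * (1 / ε)
  dk_le : ∀ θ, ∀ t ∈ timeInterval ε T, |dTheta k θ t| ≤ M
  da_le : ∀ θ, ∀ t ∈ timeInterval ε T, |dTheta a θ t| ≤ M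
  a_le : ∀ θ, ∀ t ∈ timeInterval ε T, |a θ t| ≤ M
  sub_le : ∀ θ, ∀ t ∈ timeInterval ε T, |w θ t - z θ t| ≤ 2 * M
  w_le : ∀ θ, ∀ t ∈ timeInterval ε T, |w θ t| ≤ M

section

variable {M β₁ γ₁ : ℝ} {w z k a : ℝ → ℝ → ℝ}

theorem HasBounds.coeffBounds (hM : 1 ≤ M) (hβ : -1 < β₁) (hγ : 0 < γ₁) (hε : 0 < ε)
    (hε1 : ε ≤ 1) (hb : HasBounds M β₁ γ₁ ε T w z k a) : CoeffBounds M ε T w z k a where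
  dz_le θ t ht := by
    have h : ε ^ β₁ ≤ 1 / ε := by
      rw [one_div, ← Real.rpow_neg_one]
      exact Real.rpow_le_rpow_of_exponent_ge hε hε1 hβ.le
    exact (hb.dz_le θ t ht).trans (mul_le_mul_of_nonneg_left h (by linarith))
  dk_le θ t ht := by
    have h : ε ^ γ₁ ≤ 1 := Real.rpow_le_one hε.le hε1 hγ.le
    exact (hb.dk_le θ t ht).trans (mul_le_of_le_one_right (by linarith) h)
  da_le := hb.da_le
  a_le := hb.a_le
  sub_le θ t ht := by
    have h := hb.c_sim θ t ht
    have h0 : 0 ≤ 1 / M := by positivity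
    unfold soundSpeed at h
    rw [abs_le]
    constructor <;> linarith [h.1, h.2]
  w_le θ t ht := by
    have h := hb.w_sim θ t ht
    have h0 : 0 ≤ 1 / M := by positivity
    rw [abs_le]
    constructor <;> linarith [h.1, h.2]

theorem abs_dTheta_sub_goodSlope_le (hM : 1 ≤ M) (hb : CoeffBounds M ε T w z k a)
    (θ : ℝ) {t : ℝ} (ht : t ∈ timeInterval ε T) :
    |dTheta w θ t - goodSlope w z k θ t| ≤ M ^ 2 / 4 := by
  have h : |(w θ t - z θ t) * dTheta k θ t| ≤ 2 * M * M := by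
    rw [abs_mul]
    exact mul_le_mul (hb.sub_le θ t ht) (hb.dk_le θ t ht) (abs_nonneg _) (by linarith)
  have e : dTheta w θ t - goodSlope w z k θ t = (w θ t - z θ t) * dTheta k θ t / 8 := by
    unfold goodSlope; ring
  rw [e, abs_div, abs_of_pos (by norm_num : (0 : ℝ) < 8)]
  linarith

/-- The constant `8M²/ε` is a barrier: on contact `W ≥ 7M²/ε`, where the quadratic damping wins. At
a spatial maximum the transport term vanishes. -/
theorem goodSlope_lt
    (hM : 1 ≤ M) (hε : 0 < ε) (hε1 : ε ≤ 1) (hb : CoeffBounds M ε T w z k a)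
    (h : IsSolution ε T w z k a) (hinit : ∀ θ, |dTheta w θ (-ε)| ≤ 1 / ε)
    (θ : ℝ) {t : ℝ} (ht : t ∈ timeInterval ε T) :
    goodSlope w z k θ t < 8 * M ^ 2 * (1 / ε) := by
  have hE : 1 ≤ 1 / ε := (one_le_div hε).2 hε1
  set E := 1 / ε
  have hM2 : 1 ≤ M ^ 2 := one_le_pow₀ hM
  have hME : M ^ 2 ≤ M ^ 2 * E := le_mul_of_one_le_right (by positivity) hE
  have hEM : E ≤ M ^ 2 * E := le_mul_of_one_le_left (by linarith) hM2
  have hsub : Icc (-ε) t ⊆ timeInterval ε T := fun s hs => ⟨hs.1, hs.2.trans_lt ht.2⟩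
  suffices H : ∀ θ, ∀ s ∈ Icc (-ε) t, goodSlope w z k θ s - 8 * M ^ 2 * E < 0 by
    linarith [H θ t ⟨ht.1, le_rfl⟩]
  refine neg_of_periodic_of_deriv_neg Real.two_pi_pos ?_ ?_ ?_ ?_
  · exact ((continuousOn_goodSlope h.regular_w h.regular_z h.regular_k).mono
      (prod_mono subset_rfl hsub)).sub continuousOn_const
  · intro s hs x
    have := periodic_goodSlope h.regular_w h.regular_z h.regular_k (hsub hs) x
    simp only at this ⊢
    rw [this]
  · intro x
    have h0 : -ε ∈ timeInterval ε T := hsub ⟨le_rfl, ht.1⟩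
    have h1 := (abs_le.1 (abs_dTheta_sub_goodSlope_le hM hb x h0)).1
    have h2 := (abs_le.1 (hinit x)).2
    linarith
  · intro x s hs hv hmax
    have hs' : s ∈ timeInterval ε T := hsub ⟨hs.1.le, hs.2⟩
    obtain ⟨qx, qt, hqx, hqt, heq⟩ := h.goodSlope_transport x ⟨hs.1, hs'.2⟩
    have hqx0 : qx = 0 := hmax.hasDerivAt_eq_zero (hqx.sub_const _)
    refine ⟨qt, ?_, hqt.sub_const _⟩
    have h1 := (abs_le.1 (abs_dTheta_sub_goodSlope_le hM hb x hs')).1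
    have := riccati_neg hM hE (hb.dz_le x s hs') (hb.dk_le x s hs') (hb.da_le x s hs')
      (hb.a_le x s hs') (hb.sub_le x s hs') (hb.w_le x s hs')
      (W := dTheta w x s) (by linarith)
    rw [← heq, hqx0] at this
    linarith

/-- Here the quadratic term is adverse, so the barrier for `-q` grows linearly, at rate `40M⁴/ε²`
from `2M²/ε`. The time restriction keeps it below `3M²/ε`; hence `|W| ≤ 4M²/ε` on contact, and `-q`
grows more slowly than the barrier. -/
theorem neg_goodSlope_lt
    (hM : 1 ≤ M) (hε : 0 < ε) (hε1 : ε ≤ 1) (hb : CoeffBounds M ε T w z k a)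
    (h : IsSolution ε T w z k a) (hinit : ∀ θ, |dTheta w θ (-ε)| ≤ 1 / ε)
    (θ : ℝ) {t : ℝ} (ht : t ∈ timeInterval ε T)
    (htε : 40 * M ^ 4 * (1 / ε) * (t + ε) ≤ 1) :
    -goodSlope w z k θ t < 3 * M ^ 2 * (1 / ε) := by
  have hE : 1 ≤ 1 / ε := (one_le_div hε).2 hε1
  set E := 1 / ε
  have hM2 : 1 ≤ M ^ 2 := one_le_pow₀ hM
  have hME : M ^ 2 ≤ M ^ 2 * E := le_mul_of_one_le_right (by positivity) hE
  have hEM : E ≤ M ^ 2 * E := le_mul_of_one_le_left (by linarith) hM2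
  have hsub : Icc (-ε) t ⊆ timeInterval ε T := fun s hs => ⟨hs.1, hs.2.trans_lt ht.2⟩
  have hbar : ∀ s ≤ t, 40 * M ^ 4 * E ^ 2 * (s + ε) ≤ E := by
    intro s hs
    calc 40 * M ^ 4 * E ^ 2 * (s + ε) ≤ 40 * M ^ 4 * E ^ 2 * (t + ε) := by gcongr
      _ = 40 * M ^ 4 * E * (t + ε) * E := by ring
      _ ≤ E := mul_le_of_le_one_left (by linarith) htε
  suffices H : ∀ θ, ∀ s ∈ Icc (-ε) t,
      -goodSlope w z k θ s - (2 * M ^ 2 * E + 40 * M ^ 4 * E ^ 2 * (s + ε)) < 0 by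
    linarith [H θ t ⟨ht.1, le_rfl⟩, hbar t le_rfl]
  refine neg_of_periodic_of_deriv_neg Real.two_pi_pos ?_ ?_ ?_ ?_
  · have hc : Continuous fun p : ℝ × ℝ => 2 * M ^ 2 * E + 40 * M ^ 4 * E ^ 2 * (p.2 + ε) := by
      fun_prop
    exact ((continuousOn_goodSlope h.regular_w h.regular_z h.regular_k).mono
      (prod_mono subset_rfl hsub)).neg.sub hc.continuousOn
  · intro s hs x
    have := periodic_goodSlope h.regular_w h.regular_z h.regular_k (hsub hs) x
    simp only at this ⊢
    rw [this]
  · intro x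
    have h0 : -ε ∈ timeInterval ε T := hsub ⟨le_rfl, ht.1⟩
    have h1 := (abs_le.1 (abs_dTheta_sub_goodSlope_le hM hb x h0)).2
    have h2 := (abs_le.1 (hinit x)).1
    rw [neg_add_cancel, mul_zero]
    linarith
  · intro x s hs hv hmax
    have hs' : s ∈ timeInterval ε T := hsub ⟨hs.1.le, hs.2⟩
    obtain ⟨qx, qt, hqx, hqt, heq⟩ := h.goodSlope_transport x ⟨hs.1, hs'.2⟩
    have hqx0 : -qx = 0 := hmax.hasDerivAt_eq_zero (hqx.neg.sub_const _)
    have hlin : HasDerivAt (fun s => 2 * M ^ 2 * E + 40 * M ^ 4 * E ^ 2 * (s + ε))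
        (40 * M ^ 4 * E ^ 2 * 1) s :=
      (((hasDerivAt_id s).add_const ε).const_mul _).const_add _
    refine ⟨_, ?_, hqt.neg.sub hlin⟩
    have h1 := abs_le.1 (abs_dTheta_sub_goodSlope_le hM hb x hs')
    have h2 := hbar s hs.2
    have h3 : 0 ≤ 40 * M ^ 4 * E ^ 2 * (s + ε) := mul_nonneg (by positivity) (by linarith [hs.1])
    have := neg_riccati_lt hM hE (hb.dz_le x s hs') (hb.dk_le x s hs') (hb.da_le x s hs')
      (hb.a_le x s hs') (hb.sub_le x s hs') (hb.w_le x s hs')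
      (W := dTheta w x s) (by rw [abs_le]; constructor <;> linarith [h1.1, h1.2])
    rw [← heq] at this
    rw [neg_eq_zero.1 hqx0] at this
    linarith

theorem dTheta_le
    (hM : 1 ≤ M) (hε : 0 < ε) (hε1 : ε ≤ 1) (hb : CoeffBounds M ε T w z k a)
    (h : IsSolution ε T w z k a) (hinit : ∀ θ, |dTheta w θ (-ε)| ≤ 1 / ε)
    (θ : ℝ) {t : ℝ} (ht : t ∈ timeInterval ε T) :
    dTheta w θ t ≤ 9 * M ^ 2 * (1 / ε) := by
  have hE : 1 ≤ 1 / ε := (one_le_div hε).2 hε1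
  have hME : M ^ 2 ≤ M ^ 2 * (1 / ε) := le_mul_of_one_le_right (by positivity) hE
  have h1 := (abs_le.1 (abs_dTheta_sub_goodSlope_le hM hb θ ht)).2
  have h2 := goodSlope_lt hM hε hε1 hb h hinit θ ht
  nlinarith

theorem abs_dTheta_le
    (hM : 1 ≤ M) (hε : 0 < ε) (hε1 : ε ≤ 1) (hb : CoeffBounds M ε T w z k a)
    (h : IsSolution ε T w z k a) (hinit : ∀ θ, |dTheta w θ (-ε)| ≤ 1 / ε)
    (θ : ℝ) {t : ℝ} (ht : t ∈ timeInterval ε T)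
    (htε : 40 * M ^ 4 * (1 / ε) * (t + ε) ≤ 1) :
    |dTheta w θ t| ≤ 9 * M ^ 2 * (1 / ε) := by
  have hE : 1 ≤ 1 / ε := (one_le_div hε).2 hε1
  have hME : M ^ 2 ≤ M ^ 2 * (1 / ε) := le_mul_of_one_le_right (by positivity) hE
  have h1 := (abs_le.1 (abs_dTheta_sub_goodSlope_le hM hb θ ht)).1
  have h2 := neg_goodSlope_lt hM hε hε1 hb h hinit θ ht htε
  rw [abs_le]
  exact ⟨by nlinarith, dTheta_le hM hε hε1 hb h hinit θ ht⟩

end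

/-! ### Integration along the flow -/

theorem IsFlow.continuousOn {v Ψ : ℝ → ℝ → ℝ} (hΨ : IsFlow ε T v Ψ) (x : ℝ) :
    ContinuousOn (fun τ => (Ψ x τ, τ)) (timeInterval ε T) :=
  (HasDerivWithinAt.continuousOn fun t ht => hΨ.hasDeriv x t ht).prodMk continuousOn_id

theorem IsRegular.hasDerivWithinAt_flow {f v Ψ : ℝ → ℝ → ℝ} (hf : IsRegular ε T f)
    (hΨ : IsFlow ε T v Ψ) (x : ℝ) {t : ℝ} (ht : t ∈ timeInterval ε T) :
    HasDerivWithinAt (fun τ => f (Ψ x τ) τ)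
      (dTime ε T f (Ψ x t) t + v (Ψ x t) t * dTheta f (Ψ x t) t) (timeInterval ε T) t := by
  have h1 := (hΨ.hasDeriv x t ht).prodMk (hasDerivWithinAt_id t (timeInterval ε T))
  have hmaps : MapsTo (fun τ => (Ψ x τ, id τ)) (timeInterval ε T)
      (univ ×ˢ timeInterval ε T) := fun s hs => ⟨mem_univ _, hs⟩
  have h2 := HasFDerivWithinAt.comp_hasDerivWithinAt (f := fun τ => (Ψ x τ, id τ)) t
    (hf.hasFDerivWithinAt (Ψ x t) ht) h1 hmaps
  refine h2.congr_deriv ?_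
  rw [hf.dTheta_eq _ ht, hf.dTime_eq _ ht]
  have e : ((v (Ψ x t) t, 1) : ℝ × ℝ) = (0, 1) + v (Ψ x t) t • (1, 0) := by simp
  rw [e, map_add, map_smul, smul_eq_mul, id]

theorem abs_source_le {M d K w a : ℝ} (hM : 1 ≤ M) (hK : |K| ≤ M) (ha : |a| ≤ M)
    (hd : |d| ≤ 2 * M) (hw : |w| ≤ M) :
    |-(8 / 3) * a * w + 1 / 24 * d ^ 2 * K| ≤ 3 * M ^ 3 := by
  have h1 : |a * w| ≤ M * M := by
    rw [abs_mul]; exact mul_le_mul ha hw (abs_nonneg _) (by linarith)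
  have h2 : d ^ 2 ≤ (2 * M) ^ 2 := sq_le_sq' (abs_le.1 hd).1 (abs_le.1 hd).2
  have h3 : |d ^ 2 * K| ≤ (2 * M) ^ 2 * M := by
    rw [abs_mul, abs_of_nonneg (sq_nonneg d)]
    exact mul_le_mul h2 hK (abs_nonneg _) (by positivity)
  have h4 : M ^ 2 ≤ M ^ 3 := pow_le_pow_right₀ hM (by norm_num)
  rw [abs_le] at *
  constructor <;> nlinarith

section

variable {M β₁ γ₁ : ℝ} {w z k a : ℝ → ℝ → ℝ}

/-- Transversality: along a speed other than the third one, `|∂_θ w|` is controlled by its upper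
bound and by the derivative of `w`. -/
theorem abs_dTheta_le_deriv_flow
    (hM : 1 ≤ M) (hβ : -1 < β₁) (hγ : 0 < γ₁) (hε : 0 < ε) (hε1 : ε ≤ 1)
    (hb : HasBounds M β₁ γ₁ ε T w z k a) (h : IsSolution ε T w z k a)
    (hinit : ∀ θ, |dTheta w θ (-ε)| ≤ 1 / ε) {φ : ℝ} (hφ : 0 < φ) (θ : ℝ) {t : ℝ}
    (ht : t ∈ timeInterval ε T) :
    |dTheta w θ t| ≤ M * (18 * M ^ 3 * (1 / ε) + (3 * M ^ 3 +
      (dTime ε T w θ t + speed φ w z θ t * dTheta w θ t)) / (2 * φ)) := by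
  have hb' := hb.coeffBounds hM hβ hγ hε hε1
  have hup := dTheta_le hM hε hε1 hb' h hinit θ ht
  have hs := (abs_le.1 (abs_source_le hM (hb'.dk_le θ t ht) (hb'.a_le θ t ht)
    (hb'.sub_le θ t ht) (hb'.w_le θ t ht))).1
  have hc := hb.c_sim θ t ht
  have heq := h.eq_w θ t ht
  have hM0 : 0 < M := by linarith
  have hE : 0 < 1 / ε := by positivity
  set W := dTheta w θ t
  set c := soundSpeed w z θ t with hcdef
  -- This uses `λ - λ₃ = -φ(w - z) = -2φc`.
  have hder : dTime ε T w θ t + speed φ w z θ t * W = -(8 / 3) * a θ t * w θ t +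
      1 / 24 * (w θ t - z θ t) ^ 2 * dTheta k θ t - 2 * φ * (c * W) := by
    simp only [hcdef, soundSpeed, speed, lam3] at heq ⊢
    linear_combination heq
  have hc1 : 1 ≤ M * c := by
    have := mul_le_mul_of_nonneg_left hc.1 hM0.le
    rwa [mul_one_div_cancel hM0.ne'] at this
  have hc0 : 0 < c := (by positivity : (0 : ℝ) < 1 / M).trans_le hc.1
  have h1 : -(c * W) ≤ (3 * M ^ 3 + (dTime ε T w θ t + speed φ w z θ t * W)) / (2 * φ) := by
    rw [hder, le_div_iff₀ (by positivity)]
    linarith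
  -- `c|W| = 2cW⁺ - cW`, and `cW⁺ ≤ M · 9M²/ε`.
  have h2 : c * |W| ≤ 18 * M ^ 3 * (1 / ε) - c * W := by
    have h3 : c * (9 * M ^ 2 * (1 / ε)) ≤ M * (9 * M ^ 2 * (1 / ε)) :=
      mul_le_mul_of_nonneg_right hc.2 (by positivity)
    have h4 : c * W ≤ c * (9 * M ^ 2 * (1 / ε)) := mul_le_mul_of_nonneg_left hup hc0.le
    have h5 : 0 ≤ M ^ 3 * (1 / ε) := by positivity
    rcases abs_cases W with ⟨e, _⟩ | ⟨e, _⟩ <;> rw [e] <;> linarith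
  calc |W| ≤ (M * c) * |W| := le_mul_of_one_le_left (abs_nonneg _) hc1
    _ = M * (c * |W|) := by ring
    _ ≤ _ := mul_le_mul_of_nonneg_left (by linarith) hM0.le

/-- The cases split at `40M⁴(ε + t)/ε = 1`, where the validity of the two-sided slope bound ends and
a constant becomes at most a multiple of `(ε + t)/ε`. -/
theorem integral_abs_dTheta_flow_le
    (hM : 1 ≤ M) (hβ : -1 < β₁) (hγ : 0 < γ₁) (hε : 0 < ε) (hε1 : ε ≤ 1)
    (hb : HasBounds M β₁ γ₁ ε T w z k a) (h : IsSolution ε T w z k a)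
    (hinit : ∀ θ, |dTheta w θ (-ε)| ≤ 1 / ε) {φ : ℝ} (hφ : 0 < φ)
    {Ψ : ℝ → ℝ → ℝ} (hΨ : IsFlow ε T (speed φ w z) Ψ) (x : ℝ) {t : ℝ} (ht : t ∈ timeInterval ε T) :
    IntervalIntegrable (fun τ => |dTheta w (Ψ x τ) τ|) volume (-ε) t ∧
      ∫ τ in (-ε)..t, |dTheta w (Ψ x τ) τ| ≤
        40 * M ^ 6 * max 1 (1 / φ) * ((ε + t) / ε) := by
  have hsub : Icc (-ε) t ⊆ timeInterval ε T := fun s hs => ⟨hs.1, hs.2.trans_lt ht.2⟩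
  have hcont : ContinuousOn (fun τ => |dTheta w (Ψ x τ) τ|) (Icc (-ε) t) := by
    have h1 := h.regular_w.continuousOn_dTheta.comp (hΨ.continuousOn x)
      (fun s hs => ⟨mem_univ _, hs⟩)
    exact (h1.mono hsub).abs
  have hintg : IntervalIntegrable (fun τ => |dTheta w (Ψ x τ) τ|) volume (-ε) t :=
    hcont.intervalIntegrable_of_Icc ht.1
  refine ⟨hintg, ?_⟩
  have hE : 1 ≤ 1 / ε := (one_le_div hε).2 hε1
  set m := max 1 (1 / φ)
  have hm1 : 1 ≤ m := le_max_left _ _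
  have hmφ : 1 / φ ≤ m := le_max_right _ _
  set s := (ε + t) / ε with hs
  have hεt : 0 ≤ t + ε := by linarith [ht.1]
  have hs0 : 0 ≤ s := by rw [hs]; exact div_nonneg (by linarith) hε.le
  have hsE : 1 / ε * (t + ε) = s := by rw [hs]; ring
  have hts : t + ε ≤ s := by rw [← hsE]; exact le_mul_of_one_le_left hεt hE
  have hms : s ≤ m * s := le_mul_of_one_le_left hs0 hm1
  have hM0 : 0 < M := by linarith
  rcases le_total (40 * M ^ 4 * (1 / ε) * (t + ε)) 1 with hearly | hlate
  · have hb' := hb.coeffBounds hM hβ hγ hε hε1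
    have h1 : ∫ τ in (-ε)..t, |dTheta w (Ψ x τ) τ| ≤ ∫ τ in (-ε)..t, 9 * M ^ 2 * (1 / ε) := by
      refine intervalIntegral.integral_mono_on ht.1 hintg intervalIntegrable_const fun τ hτ => ?_
      refine abs_dTheta_le hM hε hε1 hb' h hinit _ (hsub hτ) (le_trans ?_ hearly)
      gcongr
      exact hτ.2
    rw [intervalIntegral.integral_const, smul_eq_mul] at h1
    have h2 : (t - -ε) * (9 * M ^ 2 * (1 / ε)) = 9 * M ^ 2 * s := by rw [← hsE]; ring
    have h3 : M ^ 2 ≤ M ^ 6 := pow_le_pow_right₀ hM (by norm_num)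
    have h4 : M ^ 2 * s ≤ M ^ 6 * (m * s) := mul_le_mul h3 hms hs0 (by positivity)
    have h5 : 0 ≤ M ^ 6 * (m * s) := by positivity
    nlinarith
  · set H : ℝ → ℝ := fun τ => w (Ψ x τ) τ with hH
    have hd : ∀ τ ∈ timeInterval ε T, HasDerivWithinAt
        (fun τ => M * (18 * M ^ 3 * (1 / ε) * τ + (3 * M ^ 3 * τ + H τ) / (2 * φ)))
        (M * (18 * M ^ 3 * (1 / ε) + (3 * M ^ 3 + (dTime ε T w (Ψ x τ) τ +
          speed φ w z (Ψ x τ) τ * dTheta w (Ψ x τ) τ)) / (2 * φ))) (timeInterval ε T) τ := by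
      intro τ hτ
      have h1 := h.regular_w.hasDerivWithinAt_flow hΨ x hτ
      have h2 := hasDerivWithinAt_id τ (timeInterval ε T)
      refine (((h2.const_mul (18 * M ^ 3 * (1 / ε))).add
        (((h2.const_mul (3 * M ^ 3)).add h1).div_const (2 * φ))).const_mul M).congr_deriv ?_
      ring
    have h1 := intervalIntegral.integral_le_sub_of_hasDeriv_right_of_le ht.1
      ((HasDerivWithinAt.continuousOn hd).mono hsub)
      (fun τ hτ => ((hd τ (hsub (Ioo_subset_Icc_self hτ))).hasDerivAt
        (Ico_mem_nhds hτ.1 (hτ.2.trans ht.2))).hasDerivWithinAt)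
      (hcont.integrableOn_Icc)
      (fun τ hτ => abs_dTheta_le_deriv_flow hM hβ hγ hε hε1 hb h hinit hφ (Ψ x τ)
        (hsub (Ioo_subset_Icc_self hτ)))
    refine h1.trans ?_
    have hw1 := (hb.w_sim (Ψ x t) t ht).2
    have hw2 := (hb.w_sim (Ψ x (-ε)) (-ε) (hsub ⟨le_rfl, ht.1⟩)).1
    have hw3 : 0 < 1 / M := by positivity
    -- Lateness absorbs the change of `w`, at most `M`, into `40M⁵s`. The total is then `(18 +
    -- 3/2)M⁴ + 20M⁶` times `max 1 (1/φ) · s`, at most the claimed `40M⁶`.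
    have hlate' : 1 ≤ 40 * M ^ 4 * s := by rw [← hsE]; linarith
    have e : M * (18 * M ^ 3 * (1 / ε) * t + (3 * M ^ 3 * t + H t) / (2 * φ)) -
        M * (18 * M ^ 3 * (1 / ε) * (-ε) + (3 * M ^ 3 * (-ε) + H (-ε)) / (2 * φ)) =
        18 * M ^ 4 * s + M / 2 * (3 * M ^ 3 * (t + ε) + (H t - H (-ε))) * (1 / φ) := by
      rw [← hsE]; field_simp; ring
    rw [e]
    have h2 : 3 * M ^ 3 * (t + ε) + (H t - H (-ε)) ≤ 3 * M ^ 3 * s + M * (40 * M ^ 4 * s) := by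
      have : M ≤ M * (40 * M ^ 4 * s) := le_mul_of_one_le_right hM0.le hlate'
      have : 3 * M ^ 3 * (t + ε) ≤ 3 * M ^ 3 * s := by gcongr
      have : H t - H (-ε) ≤ M := by simp only [hH]; linarith
      linarith
    have h3 : M / 2 * (3 * M ^ 3 * (t + ε) + (H t - H (-ε))) * (1 / φ) ≤
        M / 2 * (3 * M ^ 3 * s + M * (40 * M ^ 4 * s)) * m := by
      refine mul_le_mul ?_ hmφ (by positivity) (by positivity)
      gcongr
    have h4 : M ^ 4 ≤ M ^ 6 := pow_le_pow_right₀ hM (by norm_num)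
    have h5 : M ^ 4 * s ≤ M ^ 6 * (m * s) := mul_le_mul h4 hms hs0 (by positivity)
    have h6 : M ^ 4 * (m * s) ≤ M ^ 6 * (m * s) := by gcongr
    have h7 : 0 ≤ M ^ 6 * (m * s) := by positivity
    nlinarith

end

/-! ### Passage to the final time -/

/-- A bound on the integrals of a nonnegative function over `[a, t]`, `t < b`, by a constant
multiple of `t - a` extends to `t = b`. -/
theorem intervalIntegrable_and_integral_le_of_lt {f : ℝ → ℝ} {a b c : ℝ} (hab : a < b)
    (hc : 0 ≤ c) (hf : ∀ x, 0 ≤ f x)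
    (h : ∀ t ∈ Ico a b, IntervalIntegrable f volume a t ∧ ∫ x in a..t, f x ≤ c * (t - a)) :
    IntervalIntegrable f volume a b ∧ ∫ x in a..b, f x ≤ c * (b - a) := by
  obtain ⟨u, -, hu, hutend⟩ := exists_seq_strictMono_tendsto' hab
  have hu' : ∀ n, u n ∈ Ico a b := fun n => Ioo_subset_Ico_self (hu n)
  have hintg : IntegrableOn f (Ioc a b) := by
    -- For a nonnegative function, bounded integrals over an exhausting sequence of intervals give
    -- integrability up to `b`.
    refine integrableOn_Ioc_of_intervalIntegral_norm_bounded_right (l := atTop) (b := u)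
      (I := c * (b - a))
      (fun n => (intervalIntegrable_iff_integrableOn_Ioc_of_le (hu' n).1).1 (h _ (hu' n)).1)
      hutend (Eventually.of_forall fun n => ?_)
    simp only [Real.norm_of_nonneg (hf _)]
    rw [← intervalIntegral.integral_of_le (hu' n).1]
    refine (h _ (hu' n)).2.trans ?_
    gcongr
    exact (hu' n).2.le
  have hintg' : IntervalIntegrable f volume a b :=
    (intervalIntegrable_iff_integrableOn_Ioc_of_le hab.le).2 hintg
  refine ⟨hintg', ?_⟩
  have hcont := intervalIntegral.continuousOn_primitive_interval
    (f := f) (μ := volume) (a := a) (b := b)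
    (by rwa [uIcc_of_le hab.le, integrableOn_Icc_iff_integrableOn_Ioc])
  have hlim := (hcont b right_mem_uIcc).tendsto.comp (tendsto_nhdsWithin_iff.2
    ⟨hutend, Eventually.of_forall fun n => by
      rw [uIcc_of_le hab.le]; exact Ico_subset_Icc_self (hu' n)⟩)
  refine le_of_tendsto hlim (Eventually.of_forall fun n => (h _ (hu' n)).2.trans ?_)
  gcongr
  exact (hu' n).2.le

end AzimuthalEuler

theorem lemma3p1 (M : ℝ) (hM : 1 ≤ M) :
    ∃ C : ℝ, 0 < C ∧
      ∀ (β₁ γ₁ : ℝ), -1 < β₁ → 0 < γ₁ →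
      ∀ (ε T : ℝ), 0 < ε → ε ≤ 1 → -ε ≤ T → T ≤ ε →
      ∀ (w z k a : ℝ → ℝ → ℝ),
        AzimuthalEuler.IsSolution ε T w z k a →
        (∀ θ : ℝ, |AzimuthalEuler.dTheta w θ (-ε)| ≤ 1 / ε) →
        AzimuthalEuler.HasBounds M β₁ γ₁ ε T w z k a →
      ∀ (φ : ℝ), 0 < φ →
      ∀ (Ψ : ℝ → ℝ → ℝ), AzimuthalEuler.IsFlow ε T (AzimuthalEuler.speed φ w z) Ψ →
      ∀ (x t : ℝ), t ∈ Set.Icc (-ε) T →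
        IntervalIntegrable (fun τ => |AzimuthalEuler.dTheta w (Ψ x τ) τ|)
            MeasureTheory.volume (-ε) t ∧
          ∫ τ in (-ε)..t, |AzimuthalEuler.dTheta w (Ψ x τ) τ| ≤
            C * max 1 (1 / φ) * ((ε + t) / ε) := by
  refine ⟨40 * M ^ 6, by positivity, ?_⟩
  intro β₁ γ₁ hβ hγ ε T hε hε1 _ _ w z k a h hinit hb φ hφ Ψ hΨ x t ht
  have key := fun {s : ℝ} (hs : s ∈ AzimuthalEuler.timeInterval ε T) =>
    AzimuthalEuler.integral_abs_dTheta_flow_le hM hβ hγ hε hε1 hb h hinit hφ hΨ x hs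
  -- The solution and the flow are only controlled before `T`, so `t = T` is reached as a limit,
  -- unless `T = -ε` and both sides vanish.
  rcases ht.2.lt_or_eq with htT | rfl
  · exact key ⟨ht.1, htT⟩
  rcases ht.1.lt_or_eq with hlt | heq
  · have e : ∀ s : ℝ, 40 * M ^ 6 * max 1 (1 / φ) * ((ε + s) / ε) =
        40 * M ^ 6 * max 1 (1 / φ) / ε * (s - -ε) := fun s => by ring
    rw [e]
    refine AzimuthalEuler.intervalIntegrable_and_integral_le_of_lt hlt (by positivity)
      (fun _ => abs_nonneg _) fun s hs => ?_
    rw [← e]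
    exact key hs
  · subst heq
    simp
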